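/- Let $\mathcal M$ be a von Neumann algebra on a complex Hilbert space with a normal faithful tracial state $\tau$. For $p\ge 1$ and $x\in\mathcal M$ put $\|x\|_p=\tau(|x|^p)^{1/p}$, and let $L^p(\mathcal M)$ be the completion of $\mathcal M$ with respect to $\|\cdot\|_p$. The identity of $\mathcal M$ extends to a contraction $L^2(\mathcal M)\to L^1(\mathcal M)$, through which $\|X\|_1$ is defined for $X\in L^2(\mathcal M)$; left and right multiplication by elements of $\mathcal M$ extend to bounded operators on $L^2(\mathcal M)$. For a positive invertible $B\in\mathcal M$ and $X\in L^2(\mathcal M)$ let $$\|X\|_{B,2}=\|B^{-1/4}XB^{-1/4}\|_2 .$$ **Theorem.** For every $X\in L^2(\mathcal M)$ and every positive invertible $B\in\mathcal M$ with $\tau(B)=1$, $$\|X\|_1^2\le\|X\|_{B,2}^2 .$$ -/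

import Mathlib

open scoped ComplexOrder

/-! ## A von Neumann algebra as an ordered C⋆-algebra -/

namespace VonNeumannAlgebra

variable {H : Type*} [NormedAddCommGroup H] [InnerProductSpace ℂ H] [CompleteSpace H]

instance instSMulMemClass : SMulMemClass (VonNeumannAlgebra H) ℂ (H →L[ℂ] H) where
  smul_mem {S} r _ hx := S.toStarSubalgebra.smul_mem hx r

theorem isClosed_coe (M : VonNeumannAlgebra H) : IsClosed (M : Set (H →L[ℂ] H)) := by
  rw [← M.centralizer_centralizer]
  exact Set.isClosed_centralizer _

noncomputable instance instCStarAlgebra (M : VonNeumannAlgebra H) : CStarAlgebra M :=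
  StarSubalgebra.cstarAlgebra M (h_closed := M.isClosed_coe)

theorem sqrt_mem (M : VonNeumannAlgebra H) {a : H →L[ℂ] H} (ha : a ∈ M) :
    CFC.sqrt a ∈ M := by
  rw [← commutant_commutant M, mem_commutant_iff]
  intro g hg
  have h : Commute a g := (mem_commutant_iff.1 hg a ha)
  exact (h.cfcₙ_nnreal _).symm.eq

/-- The order of `M` is the one induced by the Loewner order of `B(H)`; it is also the order
given by the cone of elements `star s * s` with `s` in `M`. -/
instance instStarOrderedRing (M : VonNeumannAlgebra H) : StarOrderedRing M :=
  StarOrderedRing.of_nonneg_iff'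
    (fun {x y} h z => by
      change (z : H →L[ℂ] H) + x ≤ z + y
      exact add_le_add_right (show (x : H →L[ℂ] H) ≤ y from h) _)
    (fun x => by
      constructor
      · intro h
        have h' : (0 : H →L[ℂ] H) ≤ x := h
        refine ⟨⟨CFC.sqrt (x : H →L[ℂ] H), M.sqrt_mem x.2⟩, Subtype.ext ?_⟩
        change (x : H →L[ℂ] H) = star (CFC.sqrt (x : H →L[ℂ] H)) * CFC.sqrt (x : H →L[ℂ] H)
        rw [(IsSelfAdjoint.of_nonneg (CFC.sqrt_nonneg (x : H →L[ℂ] H))).star_eq,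
          CFC.sqrt_mul_sqrt_self _ h']
      · rintro ⟨s, rfl⟩
        change (0 : H →L[ℂ] H) ≤ star (s : H →L[ℂ] H) * s
        exact star_mul_self_nonneg _)

end VonNeumannAlgebra

/-! ## Traces on a C⋆-algebra: the `1`-norm and the `2`-norm -/

namespace TraceNorm

variable {A : Type*} [CStarAlgebra A] [PartialOrder A] (f : A →ₚ[ℂ] ℂ)

theorem re_mono {a b : A} (h : a ≤ b) : (f a).re ≤ (f b).re :=
  (Complex.le_def.1 (OrderHomClass.mono f h)).1

theorem re_nonneg {a : A} (h : 0 ≤ a) : 0 ≤ (f a).re :=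
  (Complex.le_def.1 (f.map_nonneg h)).1

theorem re_smul (r : ℝ) (a : A) : (f (r • a)).re = r * (f a).re := by
  rw [← Complex.coe_smul, map_smul]
  simp

variable [StarOrderedRing A]

theorem norm_apply_star_mul_le (a b : A) :
    ‖f (star a * b)‖ ≤ √(f (star a * a)).re * √(f (star b * b)).re :=
  norm_inner_le_norm (𝕜 := ℂ) (f.toPreGNS a) (f.toPreGNS b)

/-- For `ε > 0` the element `|x| + ε` is an invertible square `s * s`, `s` self-adjoint. -/
theorem exists_sqrt (x : A) {ε : ℝ} (hε : 0 < ε) :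
    ∃ s t : A, IsSelfAdjoint s ∧ IsSelfAdjoint t ∧ s * s = CFC.abs x + algebraMap ℝ A ε ∧
      s * t = 1 ∧ t * s = 1 := by
  have h0 : 0 ≤ CFC.abs x + algebraMap ℝ A ε :=
    add_nonneg (CFC.abs_nonneg x) (algebraMap_nonneg A hε.le)
  have hu : IsUnit (CFC.abs x + algebraMap ℝ A ε) := by
    refine CStarAlgebra.isUnit_of_le (algebraMap ℝ A ε)
      (le_add_of_nonneg_left (CFC.abs_nonneg x)) ?_
    exact ⟨algebraMap_nonneg A hε.le, (IsUnit.mk0 ε hε.ne').map (algebraMap ℝ A)⟩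
  have hs : IsSelfAdjoint (CFC.sqrt (CFC.abs x + algebraMap ℝ A ε)) :=
    IsSelfAdjoint.of_nonneg (CFC.sqrt_nonneg _)
  have hss := CFC.sqrt_mul_sqrt_self _ h0
  have hus : IsUnit (CFC.sqrt (CFC.abs x + algebraMap ℝ A ε)) := by
    rw [← hss] at hu
    exact ((Commute.refl _).isUnit_mul_iff.1 hu).1
  obtain ⟨u, hu'⟩ := hus
  refine ⟨u, ↑u⁻¹, hu' ▸ hs, ?_, hu' ▸ hss, by simp, by simp⟩
  have h1 : star (↑u⁻¹ : A) * u = 1 := by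
    have := congrArg star (show (u : A) * ↑u⁻¹ = 1 by simp)
    rw [hu', star_mul, hs.star_eq, star_one] at this
    rw [hu', this]
  exact (Units.eq_inv_of_mul_eq_one_right h1)

theorem star_mul_self_le (x : A) {ε : ℝ} (hε : 0 < ε) :
    star x * x ≤ (CFC.abs x + algebraMap ℝ A ε) * (CFC.abs x + algebraMap ℝ A ε) := by
  rw [← CFC.abs_mul_abs x]
  have h : (CFC.abs x + algebraMap ℝ A ε) * (CFC.abs x + algebraMap ℝ A ε) =
      CFC.abs x * CFC.abs x + ((2 * ε) • CFC.abs x + algebraMap ℝ A (ε * ε)) := by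
    simp only [Algebra.algebraMap_eq_smul_one, add_mul, mul_add, smul_mul_assoc, mul_smul_comm,
      mul_one, one_mul]
    module
  rw [h]
  exact le_add_of_nonneg_right (add_nonneg (smul_nonneg (by positivity) (CFC.abs_nonneg x))
    (algebraMap_nonneg A (by positivity)))

theorem re_apply_abs_add (x : A) (ε : ℝ) :
    (f (CFC.abs x + algebraMap ℝ A ε)).re = (f (CFC.abs x)).re + ε * (f 1).re := by
  rw [Algebra.algebraMap_eq_smul_one, map_add, Complex.add_re, re_smul]

/-- Hölder's inequality for `p = 1`, `q = ∞`. -/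
theorem norm_apply_mul_le (hf : ∀ x y : A, f (x * y) = f (y * x)) (c x : A) :
    ‖f (c * x)‖ ≤ ‖c‖ * (f (CFC.abs x)).re := by
  have key : ∀ ε : ℝ, 0 < ε → ‖f (c * x)‖ ≤ ‖c‖ * ((f (CFC.abs x)).re + ε * (f 1).re) := by
    intro ε hε
    obtain ⟨s, t, hs, ht, hss, hst, hts⟩ := exists_sqrt x hε
    have hn : 0 ≤ (f (CFC.abs x)).re + ε * (f 1).re :=
      add_nonneg (re_nonneg f (CFC.abs_nonneg x)) (mul_nonneg hε.le (re_nonneg f zero_le_one))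
    have h1 : ‖f (c * x)‖ ≤ √(f (c * x * t * star (c * x * t))).re * √(f (s * s)).re := by
      have := norm_apply_star_mul_le f (star (c * x * t)) s
      rwa [star_star, hs.star_eq, mul_assoc (c * x) t s, hts, mul_one] at this
    have h2 : (f (c * x * t * star (c * x * t))).re ≤
        ‖c‖ ^ 2 * ((f (CFC.abs x)).re + ε * (f 1).re) := by
      rw [hf]
      have e1 : star (c * x * t) * (c * x * t) ≤ ‖c‖ ^ 2 • (s * s) := by
        calc star (c * x * t) * (c * x * t)
            = star (x * t) * (star c * c) * (x * t) := by simp only [star_mul, mul_assoc]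
          _ ≤ ‖star c * c‖ • (star (x * t) * (x * t)) :=
              CStarAlgebra.star_left_conjugate_le_norm_smul
          _ = ‖c‖ ^ 2 • (star t * (star x * x) * t) := by
              rw [CStarRing.norm_star_mul_self, sq, star_mul]
              simp only [mul_assoc]
          _ ≤ ‖c‖ ^ 2 • (star t * ((s * s) * (s * s)) * t) := by
              refine smul_le_smul_of_nonneg_left ?_ (by positivity)
              rw [hss]
              exact star_left_conjugate_le_conjugate (star_mul_self_le x hε) t
          _ = ‖c‖ ^ 2 • (s * s) := by
              congr 1
              calc star t * ((s * s) * (s * s)) * t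
                  = (t * s) * s * s * (s * t) := by rw [ht.star_eq]; simp only [mul_assoc]
                _ = s * s := by rw [hts, hst, one_mul, mul_one]
      have e2 := re_mono f e1
      rwa [re_smul, hss, re_apply_abs_add] at e2
    rw [hss, re_apply_abs_add] at h1
    calc ‖f (c * x)‖ ≤ _ := h1
      _ ≤ √(‖c‖ ^ 2 * ((f (CFC.abs x)).re + ε * (f 1).re)) *
            √((f (CFC.abs x)).re + ε * (f 1).re) := by gcongr
      _ = ‖c‖ * ((f (CFC.abs x)).re + ε * (f 1).re) := by
          rw [Real.sqrt_mul (by positivity), Real.sqrt_sq (norm_nonneg c), mul_assoc,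
            Real.mul_self_sqrt hn]
  have hlim : Filter.Tendsto (fun ε : ℝ => ‖c‖ * ((f (CFC.abs x)).re + ε * (f 1).re))
      (nhdsWithin 0 (Set.Ioi 0)) (nhds (‖c‖ * ((f (CFC.abs x)).re + 0 * (f 1).re))) :=
    (Continuous.tendsto (by fun_prop) 0).mono_left nhdsWithin_le_nhds
  have := ge_of_tendsto hlim (Filter.eventually_of_mem self_mem_nhdsWithin key)
  simpa using this

theorem exists_norm_le_one_apply (x : A) {ε : ℝ} (hε : 0 < ε) :
    ∃ c : A, ‖c‖ ≤ 1 ∧ (f (CFC.abs x)).re ≤ ‖f (c * x)‖ + ε * (f 1).re := by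
  obtain ⟨s, t, hs, ht, hss, hst, hts⟩ := exists_sqrt x hε
  have hc : t * t * (s * s) = 1 := by
    rw [show t * t * (s * s) = t * (t * s) * s by simp only [mul_assoc], hts, mul_one, hts]
  have hc' : (s * s) * (t * t) = 1 := by
    rw [show s * s * (t * t) = s * (s * t) * t by simp only [mul_assoc], hst, mul_one, hst]
  have htt : star (t * t) = t * t := by rw [star_mul, ht.star_eq]
  refine ⟨t * t * star x, ?_, ?_⟩
  · have h1 : (t * t * star x) * star (t * t * star x) ≤ 1 := by
      calc (t * t * star x) * star (t * t * star x)
          = star (t * t) * (star x * x) * (t * t) := by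
            rw [star_mul, star_star, htt]; simp only [mul_assoc]
        _ ≤ star (t * t) * ((s * s) * (s * s)) * (t * t) := by
            rw [hss]
            exact star_left_conjugate_le_conjugate (star_mul_self_le x hε) _
        _ = (t * t * (s * s)) * ((s * s) * (t * t)) := by rw [htt]; simp only [mul_assoc]
        _ = 1 := by rw [hc, hc', one_mul]
    rw [← CStarAlgebra.norm_le_one_iff_of_nonneg _ (mul_star_self_nonneg _),
      CStarRing.norm_self_mul_star] at h1
    nlinarith [norm_nonneg (t * t * star x)]
  · have h1 : t * t * star x * x = CFC.abs x - ε • ((1 : A) - ε • (t * t)) := by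
      have e : CFC.abs x = s * s - ε • (1 : A) := by
        rw [hss, Algebra.algebraMap_eq_smul_one, add_sub_cancel_right]
      rw [mul_assoc, ← CFC.abs_mul_abs x, e]
      simp only [mul_sub, sub_mul, mul_smul_comm, smul_mul_assoc, mul_one, one_mul, smul_sub]
      rw [← mul_assoc (t * t), hc, one_mul]
    have h2 : (f (t * t * star x * x)).re =
        (f (CFC.abs x)).re - ε * ((f 1).re - ε * (f (t * t)).re) := by
      rw [h1, map_sub, Complex.sub_re, re_smul, map_sub, Complex.sub_re, re_smul]
    have h3 : 0 ≤ (f (t * t)).re := re_nonneg f (by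
      have := star_mul_self_nonneg t
      rwa [ht.star_eq] at this)
    have h4 := Complex.re_le_norm (f (t * t * star x * x))
    have h5 : 0 ≤ ε * (ε * (f (t * t)).re) := by positivity
    nlinarith

/-- Triangle inequality for the `1`-norm. -/
theorem re_apply_abs_add_le (hf : ∀ x y : A, f (x * y) = f (y * x)) (x y : A) :
    (f (CFC.abs (x + y))).re ≤ (f (CFC.abs x)).re + (f (CFC.abs y)).re := by
  have key : ∀ ε : ℝ, 0 < ε →
      (f (CFC.abs (x + y))).re ≤ (f (CFC.abs x)).re + (f (CFC.abs y)).re + ε * (f 1).re := by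
    intro ε hε
    obtain ⟨c, hc, h⟩ := exists_norm_le_one_apply f (x + y) hε
    have h1 : ‖f (c * (x + y))‖ ≤ ‖f (c * x)‖ + ‖f (c * y)‖ := by
      rw [mul_add, map_add]
      exact norm_add_le _ _
    have h2 : ∀ z : A, ‖f (c * z)‖ ≤ (f (CFC.abs z)).re := fun z =>
      (norm_apply_mul_le f hf c z).trans
        (mul_le_of_le_one_left (re_nonneg f (CFC.abs_nonneg z)) hc)
    linarith [h2 x, h2 y]
  have hlim : Filter.Tendsto
      (fun ε : ℝ => (f (CFC.abs x)).re + (f (CFC.abs y)).re + ε * (f 1).re)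
      (nhdsWithin 0 (Set.Ioi 0))
      (nhds ((f (CFC.abs x)).re + (f (CFC.abs y)).re + 0 * (f 1).re)) :=
    (Continuous.tendsto (by fun_prop) 0).mono_left nhdsWithin_le_nhds
  have := ge_of_tendsto hlim (Filter.eventually_of_mem self_mem_nhdsWithin key)
  simpa using this

theorem re_apply_abs_smul (r : ℂ) (x : A) :
    (f (CFC.abs (r • x))).re = ‖r‖ * (f (CFC.abs x)).re := by
  rw [CFC.abs_smul, re_smul]

/-- The `1`-norm is dominated by the `2`-norm. -/
theorem re_apply_abs_le (x : A) :
    (f (CFC.abs x)).re ≤ √(f 1).re * √(f (star x * x)).re := by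
  have h := norm_apply_star_mul_le f 1 (CFC.abs x)
  rw [star_one, one_mul, one_mul, (IsSelfAdjoint.of_nonneg (CFC.abs_nonneg x)).star_eq,
    CFC.abs_mul_abs] at h
  exact (Complex.re_le_norm _).trans h

/-- Right multiplication by `b` is bounded by `‖b‖` for the `2`-norm. -/
theorem re_apply_star_mul_right_le (hf : ∀ x y : A, f (x * y) = f (y * x)) (x b : A) :
    (f (star (x * b) * (x * b))).re ≤ ‖b‖ ^ 2 * (f (star x * x)).re := by
  rw [hf (star (x * b)), hf (star x), ← re_smul]
  refine re_mono f ?_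
  calc x * b * star (x * b) = star (star x) * (b * star b) * star x := by
        simp only [star_mul, star_star, mul_assoc]
    _ ≤ ‖b * star b‖ • (star (star x) * star x) :=
        CStarAlgebra.star_left_conjugate_le_norm_smul
    _ = ‖b‖ ^ 2 • (x * star x) := by rw [CStarRing.norm_self_mul_star, star_star, sq]

end TraceNorm

/-! ## Tracial von Neumann algebras and their `L¹` and `L²` spaces -/

namespace VonNeumannAlgebra

variable {H : Type*} [NormedAddCommGroup H] [InnerProductSpace ℂ H] [CompleteSpace H]

/-- A normal faithful tracial state on the von Neumann algebra `M`. -/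
structure TracialState (M : VonNeumannAlgebra H) extends M →ₚ[ℂ] ℂ where
  map_one : toPositiveLinearMap 1 = 1
  tracial : ∀ x y : M, toPositiveLinearMap (x * y) = toPositiveLinearMap (y * x)
  faithful : ∀ x : M, toPositiveLinearMap (star x * x) = 0 → x = 0
  /-- The functional preserves suprema of increasing nets of self-adjoint elements. -/
  normal : ∀ (D : Set M) (s : M), D.Nonempty → DirectedOn (· ≤ ·) D →
    (∀ x ∈ D, IsSelfAdjoint x) → IsLUB D s →
      IsLUB (toPositiveLinearMap '' D) (toPositiveLinearMap s)

namespace TracialState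

variable {M : VonNeumannAlgebra H} (τ : TracialState M)

noncomputable instance instCoeFun : CoeFun (TracialState M) (fun _ => M → ℂ) where
  coe τ := τ.toPositiveLinearMap

/-- The norm `‖x‖_p = τ(|x| ^ p) ^ (1 / p)` of `x ∈ M`. -/
noncomputable def pNorm (p : ℝ) (x : M) : ℝ := (τ (CFC.abs x ^ p)).re ^ (1 / p)

theorem pNorm_one (x : M) : τ.pNorm 1 x = (τ (CFC.abs x)).re := by
  rw [pNorm, CFC.rpow_one _ (CFC.abs_nonneg x), div_one, Real.rpow_one]

theorem pNorm_two (x : M) : τ.pNorm 2 x = √(τ (star x * x)).re := by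
  rw [pNorm, show (2 : ℝ) = ((2 : ℕ) : ℝ) by norm_num,
    CFC.rpow_natCast _ 2 (CFC.abs_nonneg x), CFC.abs_sq, Real.sqrt_eq_rpow]
  norm_num

/-- A copy of `M`, to carry the `1`-norm. -/
def PreL1 (_ : TracialState M) : Type _ := M

noncomputable instance instAddCommGroupPreL1 : AddCommGroup τ.PreL1 :=
  inferInstanceAs (AddCommGroup M)

noncomputable instance instModulePreL1 : Module ℂ τ.PreL1 :=
  inferInstanceAs (Module ℂ M)

/-- The identity of `M`, as a map onto the copy that carries the `1`-norm. -/
noncomputable def toPreL1 : M ≃ₗ[ℂ] τ.PreL1 := LinearEquiv.refl ℂ M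

noncomputable instance instNormPreL1 : Norm τ.PreL1 where
  norm x := τ.pNorm 1 (τ.toPreL1.symm x)

theorem norm_toPreL1 (x : M) : ‖τ.toPreL1 x‖ = τ.pNorm 1 x := rfl

theorem preL1_core : SeminormedSpace.Core ℂ τ.PreL1 where
  norm_nonneg x := by
    obtain ⟨x, rfl⟩ := τ.toPreL1.surjective x
    rw [norm_toPreL1, pNorm_one]
    exact TraceNorm.re_nonneg _ (CFC.abs_nonneg x)
  norm_smul c x := by
    obtain ⟨x, rfl⟩ := τ.toPreL1.surjective x
    rw [← map_smul, norm_toPreL1, norm_toPreL1, pNorm_one, pNorm_one]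
    exact TraceNorm.re_apply_abs_smul _ c x
  norm_triangle x y := by
    obtain ⟨x, rfl⟩ := τ.toPreL1.surjective x
    obtain ⟨y, rfl⟩ := τ.toPreL1.surjective y
    rw [← map_add, norm_toPreL1, norm_toPreL1, norm_toPreL1, pNorm_one, pNorm_one, pNorm_one]
    exact TraceNorm.re_apply_abs_add_le _ τ.tracial x y

noncomputable instance instSeminormedAddCommGroupPreL1 : SeminormedAddCommGroup τ.PreL1 :=
  SeminormedAddCommGroup.ofCore τ.preL1_core

noncomputable instance instNormedSpacePreL1 : NormedSpace ℂ τ.PreL1 where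
  norm_smul_le c x := (τ.preL1_core.norm_smul c x).le

/-- `L¹(M, τ)`: the completion of `M` for `‖·‖₁`. -/
abbrev L1 : Type _ := UniformSpace.Completion τ.PreL1

/-- A copy of `M`, with the inner product `⟪x, y⟫ = τ(star x * y)`, whose norm is `‖·‖₂`. -/
abbrev PreL2 : Type _ := τ.toPositiveLinearMap.PreGNS

/-- The identity of `M`, as a map onto the copy that carries the `2`-norm. -/
noncomputable abbrev toPreL2 : M ≃ₗ[ℂ] τ.PreL2 := τ.toPositiveLinearMap.toPreGNS

theorem norm_toPreL2 (x : M) : ‖τ.toPreL2 x‖ = τ.pNorm 2 x :=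
  (τ.pNorm_two x).symm

/-- `L²(M, τ)`: the completion of `M` for `‖·‖₂`. -/
abbrev L2 : Type _ := UniformSpace.Completion τ.PreL2

/-- The canonical map `L²(M, τ) → L¹(M, τ)`, the continuous extension of the identity of `M`. -/
noncomputable def l2ToL1 : τ.L2 →L[ℂ] τ.L1 :=
  ((τ.toPreL1.toLinearMap ∘ₗ τ.toPreL2.symm.toLinearMap).mkContinuous 1 fun x => by
    obtain ⟨x, rfl⟩ := τ.toPreL2.surjective x
    rw [LinearMap.comp_apply, LinearEquiv.coe_coe, LinearEquiv.coe_coe,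
      LinearEquiv.symm_apply_apply, norm_toPreL1, norm_toPreL2, pNorm_one, pNorm_two]
    have h := TraceNorm.re_apply_abs_le τ.toPositiveLinearMap x
    rwa [τ.map_one, Complex.one_re, Real.sqrt_one] at h).completion

theorem l2ToL1_coe (x : M) : τ.l2ToL1 (τ.toPreL2 x : τ.L2) = (τ.toPreL1 x : τ.L1) := by
  simp [l2ToL1]

/-- Left multiplication `L_b : x ↦ b * x` on `L²(M, τ)`. -/
noncomputable def leftMul (b : M) : τ.L2 →L[ℂ] τ.L2 := τ.toPositiveLinearMap.gnsStarAlgHom b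

theorem leftMul_coe (b x : M) :
    τ.leftMul b (τ.toPreL2 x : τ.L2) = (τ.toPreL2 (b * x) : τ.L2) := by
  simp [leftMul]

/-- Right multiplication `R_b : x ↦ x * b` on `L²(M, τ)`. -/
noncomputable def rightMul (b : M) : τ.L2 →L[ℂ] τ.L2 :=
  ((τ.toPreL2.toLinearMap ∘ₗ LinearMap.mulRight ℂ b ∘ₗ
    τ.toPreL2.symm.toLinearMap).mkContinuous ‖b‖ fun x => by
      obtain ⟨x, rfl⟩ := τ.toPreL2.surjective x
      rw [LinearMap.comp_apply, LinearMap.comp_apply, LinearEquiv.coe_coe, LinearEquiv.coe_coe,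
        LinearEquiv.symm_apply_apply, LinearMap.mulRight_apply, norm_toPreL2, norm_toPreL2,
        pNorm_two, pNorm_two, ← Real.sqrt_sq (norm_nonneg b), ← Real.sqrt_mul (sq_nonneg _)]
      exact Real.sqrt_le_sqrt
        (TraceNorm.re_apply_star_mul_right_le τ.toPositiveLinearMap τ.tracial x b)).completion

theorem rightMul_coe (b x : M) :
    τ.rightMul b (τ.toPreL2 x : τ.L2) = (τ.toPreL2 (x * b) : τ.L2) := by
  simp [rightMul]

/-- The Araki–Masuda `2`-norm `‖X‖_{B,2} = ‖B ^ (-1/4) X B ^ (-1/4)‖₂` of `X ∈ L²(M, τ)`, for a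
positive invertible `B ∈ M`. -/
noncomputable def arakiMasudaNorm (B : M) (X : τ.L2) : ℝ :=
  ‖τ.leftMul (B ^ (-(1 / 4) : ℝ)) (τ.rightMul (B ^ (-(1 / 4) : ℝ)) X)‖

theorem arakiMasudaNorm_coe (B x : M) :
    τ.arakiMasudaNorm B (τ.toPreL2 x : τ.L2) =
      τ.pNorm 2 (B ^ (-(1 / 4) : ℝ) * x * B ^ (-(1 / 4) : ℝ)) := by
  rw [arakiMasudaNorm, rightMul_coe, leftMul_coe, UniformSpace.Completion.norm_coe, norm_toPreL2,
    mul_assoc]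

end TracialState

end VonNeumannAlgebra

/-! ### Hölder's inequality for products `q * y * q` -/

namespace TraceNorm

variable {A : Type*} [CStarAlgebra A] [PartialOrder A] [StarOrderedRing A] (f : A →ₚ[ℂ] ℂ)

/-! For `x` in `M`, put `q = B ^ (1/4)` and `y = B ^ (-1/4) * x * B ^ (-1/4)`, so that `x = q * y *
q`. Hölder's inequality with exponents 4, 2, 4 gives `‖x‖₁ ≤ ‖q‖₄ ^ 2 * ‖y‖₂`, and `‖q‖₄ ^ 4 = τ B =
1`. Density of `M` in `L²` does the rest.

This case of Hölder (`re_apply_abs_conjugate_le`) needs no interpolation. By duality `‖q * y * q‖₁`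
is nearly `|τ (c * q * y * q)|` for some contraction `c`; cyclicity and Cauchy-Schwarz bound this by
`‖q * star c * q‖₂ * ‖y‖₂`. The first factor is controlled by `re_apply_star_conjugate_le`: a second
use of cyclicity and Cauchy-Schwarz separates the two sides of the product, and contractions then
drop out of the 2-norm. -/

theorem star_mul_self_le_one {c : A} (hc : ‖c‖ ≤ 1) : star c * c ≤ 1 := by
  rw [← CStarAlgebra.norm_le_one_iff_of_nonneg _ (star_mul_self_nonneg c),
    CStarRing.norm_star_mul_self]
  exact mul_le_one₀ hc (norm_nonneg c) hc

/-- Left multiplication by a contraction does not increase the `2`-norm. -/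
theorem re_apply_star_mul_left_le {c : A} (hc : ‖c‖ ≤ 1) (x : A) :
    (f (star (c * x) * (c * x))).re ≤ (f (star x * x)).re := by
  refine re_mono f ?_
  have := star_left_conjugate_le_conjugate (star_mul_self_le_one hc) x
  simpa only [star_mul, mul_assoc, one_mul] using this

/-- For `q` self-adjoint and `c` a contraction, `‖q * c * q‖₂ ^ 2 ≤ τ (q ^ 4)`. -/
theorem re_apply_star_conjugate_le (hf : ∀ x y : A, f (x * y) = f (y * x)) {q c : A}
    (hq : IsSelfAdjoint q) (hc : ‖c‖ ≤ 1) :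
    (f (star (q * c * q) * (q * c * q))).re ≤ (f ((q * q) * (q * q))).re := by
  have hqq : star (q * q) = q * q := by rw [star_mul, hq.star_eq]
  -- Cycling the leading `q` to the end turns the squared 2-norm of `q * c * q` into the inner
  -- product of `q² * c` and `c * q²`, where each vector has `c` on one side only.
  have e : f (star (q * c * q) * (q * c * q)) =
      f (star ((q * q) * c) * (c * (q * q))) := by
    have h1 : star (q * c * q) * (q * c * q) = q * (star c * (q * q) * c * q) := by
      simp only [star_mul, hq.star_eq, mul_assoc]
    rw [h1, hf, star_mul, hqq]
    simp only [mul_assoc]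
  have h1 : (f (star (c * (q * q)) * (c * (q * q)))).re ≤ (f ((q * q) * (q * q))).re := by
    simpa only [hqq] using re_apply_star_mul_left_le f hc (q * q)
  -- Traciality makes the adjoint a 2-norm isometry, so right multiplication by `c` reduces to left
  -- multiplication by the contraction `star c`.
  have h2 : (f (star ((q * q) * c) * ((q * q) * c))).re ≤ (f ((q * q) * (q * q))).re := by
    have h := re_apply_star_mul_left_le f (c := star c) (by rwa [norm_star]) (q * q)
    rw [hqq] at h
    rwa [hf, show q * q * c * star (q * q * c) =
      star (star c * (q * q)) * (star c * (q * q)) by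
        simp only [star_mul, star_star, hq.star_eq]]
  have h0 : 0 ≤ (f ((q * q) * (q * q))).re := by
    have := re_nonneg f (star_mul_self_nonneg (q * q))
    rwa [hqq] at this
  calc (f (star (q * c * q) * (q * c * q))).re
      ≤ ‖f (star ((q * q) * c) * (c * (q * q)))‖ := by rw [e]; exact Complex.re_le_norm _
    _ ≤ _ := norm_apply_star_mul_le f _ _
    _ ≤ √(f ((q * q) * (q * q))).re * √(f ((q * q) * (q * q))).re := by gcongr
    _ = (f ((q * q) * (q * q))).re := Real.mul_self_sqrt h0

/-- Hölder's inequality `‖q * y * q‖₁ ≤ ‖q‖₄ ^ 2 * ‖y‖₂`. -/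
theorem re_apply_abs_conjugate_le (hf : ∀ x y : A, f (x * y) = f (y * x)) {q : A}
    (hq : IsSelfAdjoint q) (y : A) :
    (f (CFC.abs (q * y * q))).re ≤
      √(f ((q * q) * (q * q))).re * √(f (star y * y)).re := by
  -- The error `ε` pays for a contraction that attains the 1-norm only approximately: a C⋆-algebra
  -- need not contain the polar part of `q * y * q`.
  have key : ∀ ε : ℝ, 0 < ε → (f (CFC.abs (q * y * q))).re ≤
      √(f ((q * q) * (q * q))).re * √(f (star y * y)).re + ε * (f 1).re := by
    intro ε hε
    obtain ⟨c, hc, h⟩ := exists_norm_le_one_apply f (q * y * q) hε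
    -- Cycling the last `q` to the front isolates `y`, leaving its inner product with `q * star c *
    -- q`.
    have e : f (c * (q * y * q)) = f (star (q * star c * q) * y) := by
      rw [← mul_assoc c, hf]
      simp only [star_mul, star_star, hq.star_eq, mul_assoc]
    have h1 := norm_apply_star_mul_le f (q * star c * q) y
    have h2 := re_apply_star_conjugate_le f hf hq (c := star c) (by rwa [norm_star])
    rw [e] at h
    have h3 := mul_le_mul_of_nonneg_right (Real.sqrt_le_sqrt h2)
      (Real.sqrt_nonneg (f (star y * y)).re)
    linarith
  have hlim : Filter.Tendsto
      (fun ε : ℝ => √(f ((q * q) * (q * q))).re * √(f (star y * y)).re + ε * (f 1).re)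
      (nhdsWithin 0 (Set.Ioi 0))
      (nhds (√(f ((q * q) * (q * q))).re * √(f (star y * y)).re + 0 * (f 1).re)) :=
    (Continuous.tendsto (by fun_prop) 0).mono_left nhdsWithin_le_nhds
  have := ge_of_tendsto hlim (Filter.eventually_of_mem self_mem_nhdsWithin key)
  simpa using this

end TraceNorm

/-! ### The norm comparison on `M` and its extension to `L²` -/

namespace VonNeumannAlgebra.TracialState

variable {H : Type*} [NormedAddCommGroup H] [InnerProductSpace ℂ H] [CompleteSpace H]
  {M : VonNeumannAlgebra H} (τ : TracialState M)

theorem pNorm_one_le_arakiMasudaNorm {B : M} (hB : 0 ≤ B) (hBunit : IsUnit B) (hτB : τ B = 1)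
    (x : M) : τ.pNorm 1 x ≤ τ.arakiMasudaNorm B (τ.toPreL2 x : τ.L2) := by
  have hadd (r s : ℝ) : B ^ r * B ^ s = B ^ (r + s) := (CFC.rpow_add hBunit).symm
  have hq : IsSelfAdjoint (B ^ (1 / 4 : ℝ)) := IsSelfAdjoint.of_nonneg CFC.rpow_nonneg
  -- The normalisation `τ B = 1` enters through this identity: it makes the Hölder constant `√(τ (q
  -- ^ 4))` equal to 1.
  have h4 : (B ^ (1 / 4 : ℝ) * B ^ (1 / 4 : ℝ)) * (B ^ (1 / 4 : ℝ) * B ^ (1 / 4 : ℝ)) = B := by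
    rw [hadd, hadd]
    norm_num
    exact CFC.rpow_one B hB
  have hl : B ^ (1 / 4 : ℝ) * B ^ (-(1 / 4) : ℝ) = 1 := by
    rw [hadd, add_neg_cancel, CFC.rpow_zero B hB]
  have hr : B ^ (-(1 / 4) : ℝ) * B ^ (1 / 4 : ℝ) = 1 := by
    rw [hadd, neg_add_cancel, CFC.rpow_zero B hB]
  have hx : B ^ (1 / 4 : ℝ) * (B ^ (-(1 / 4) : ℝ) * x * B ^ (-(1 / 4) : ℝ)) * B ^ (1 / 4 : ℝ)
      = x := by
    rw [mul_assoc, mul_assoc _ _ (B ^ (1 / 4 : ℝ)), hr, mul_one, ← mul_assoc, hl, one_mul]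
  have h := TraceNorm.re_apply_abs_conjugate_le τ.toPositiveLinearMap τ.tracial hq
    (B ^ (-(1 / 4) : ℝ) * x * B ^ (-(1 / 4) : ℝ))
  rw [hx, h4, hτB, Complex.one_re, Real.sqrt_one, one_mul] at h
  rwa [arakiMasudaNorm_coe, pNorm_one, pNorm_two]

theorem norm_l2ToL1_le_arakiMasudaNorm {B : M} (hB : 0 ≤ B) (hBunit : IsUnit B) (hτB : τ B = 1)
    (X : τ.L2) : ‖τ.l2ToL1 X‖ ≤ τ.arakiMasudaNorm B X := by
  induction X using UniformSpace.Completion.induction_on with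
  | hp =>
    unfold arakiMasudaNorm
    -- Both sides are norms of bounded operators applied to `X`, hence continuous, so it is enough
    -- to treat the dense image of `M`.
    exact isClosed_le (by fun_prop) (by fun_prop)
  | ih x =>
    obtain ⟨x, rfl⟩ := τ.toPreL2.surjective x
    rw [l2ToL1_coe, UniformSpace.Completion.norm_coe, norm_toPreL1]
    exact τ.pNorm_one_le_arakiMasudaNorm hB hBunit hτB x

end VonNeumannAlgebra.TracialState

theorem mainTheorem5 {H : Type*} [NormedAddCommGroup H] [InnerProductSpace ℂ H] [CompleteSpace H]
    (M : VonNeumannAlgebra H) (τ : VonNeumannAlgebra.TracialState M)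
    (B : M) (hB : 0 ≤ B) (hBunit : IsUnit B) (hτB : τ B = 1) (X : τ.L2) :
    ‖τ.l2ToL1 X‖ ^ 2 ≤ τ.arakiMasudaNorm B X ^ 2 :=
  pow_le_pow_left₀ (norm_nonneg _) (τ.norm_l2ToL1_le_arakiMasudaNorm hB hBunit hτB X) 2
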